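/- For a homogeneous polynomial $f\in\mathbb{C}[x,y]$ of degree $d$, let its Waring rank $\mathrm{R}(f)$ be the smallest $r$ such that $f=\ell_1^d+\cdots+\ell_r^d$ for some linear forms $\ell_1,\dots,\ell_r\in\mathbb{C}[x,y]$. Theorem 3.4. Let $k\ge 2$ be an integer, let $a,b\in\mathbb{C}$, and for $\lambda\in\mathbb{C}\setminus\{0\}$ let $f_\lambda = x^ky^k+\lambda(ax+by)^{2k}$. Then: - if $ab\neq 0$, there is a unique $\lambda_0\in\mathbb{C}\setminus\{0\}$, depending only on $k,a,b$, such that for every $\lambda\neq 0$ one has $\mathrm{R}(f_\lambda)=k$ if $\lambda=\lambda_0$ and $\mathrm{R}(f_\lambda)=k+1$ if $\lambda\neq\lambda_0$; - if $ab=0$, then $\mathrm{R}(f_\lambda)=k+1$ for every $\lambda\neq 0$. -/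

import Mathlib

open MvPolynomial

/-- `f` is a sum of `r` many `d`-th powers of complex linear forms in the variables `σ`.
The linear forms are the homogeneous polynomials of degree one (zero included). -/
def IsSumOfPowers {σ : Type*} (d : ℕ) (f : MvPolynomial σ ℂ) (r : ℕ) : Prop :=
  ∃ l : Fin r → MvPolynomial σ ℂ, (∀ i, (l i).IsHomogeneous 1) ∧ f = ∑ i, l i ^ d

/-- The Waring rank of a form `f` of degree `d` over the complex numbers: the least `r` such that
`f` is a sum of `r` many `d`-th powers of linear forms (and `⊤` if there is no such `r`). -/
noncomputable def waringRank {σ : Type*} (d : ℕ) (f : MvPolynomial σ ℂ) : ℕ∞ :=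
  sInf ((fun r : ℕ => (r : ℕ∞)) '' {r | IsSumOfPowers d f r})

/-- The Waring rank equals the natural number `r` exactly when `r` is the minimal length. -/
theorem waringRank_eq_iff {σ : Type*} (d : ℕ) (f : MvPolynomial σ ℂ) (r : ℕ) :
    waringRank d f = r ↔ IsLeast {s | IsSumOfPowers d f s} r := by
  unfold waringRank
  constructor
  · intro h
    have hne : ((fun s : ℕ => (s : ℕ∞)) '' {s | IsSumOfPowers d f s}).Nonempty := by
      by_contra hcon
      rw [Set.not_nonempty_iff_eq_empty] at hcon
      rw [hcon, sInf_empty] at h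
      exact ENat.natCast_ne_top r h.symm
    obtain ⟨s, hs, hsr⟩ := csInf_mem hne
    have hsr' : (s : ℕ∞) = (r : ℕ∞) := hsr.trans h
    have e : s = r := by exact_mod_cast hsr'
    subst e
    refine ⟨hs, fun t ht => ?_⟩
    have h2 := sInf_le (Set.mem_image_of_mem (fun s : ℕ => (s : ℕ∞)) ht)
    rw [h] at h2
    exact_mod_cast h2
  · rintro ⟨h1, h2⟩
    apply le_antisymm
    · exact sInf_le ⟨r, h1, rfl⟩
    · apply le_sInf
      rintro _ ⟨s, hs, rfl⟩
      have := h2 hs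
      exact Nat.cast_le.mpr this

/-- The binary form `x ^ k * y ^ k + c * (a * x + b * y) ^ (2 * k)`, with `x = X 0`, `y = X 1`. -/
noncomputable def binaryForm (k : ℕ) (a b c : ℂ) : MvPolynomial (Fin 2) ℂ :=
  X 0 ^ k * X 1 ^ k + C c * (C a * X 0 + C b * X 1) ^ (2 * k)

/-! Upper bounds: for z a primitive (k+1)-th root of unity, the sum of z^j (A + z^j B)^(2k) over j
is a multiple of A^k B^k. Moving its j = 0 term (A + B)^(2k) across leaves k powers at one critical
coefficient (`isSumOfPowers_critical`); any other coefficient costs one more power. If exactly one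
of a, b vanishes, k-th roots of unity serve instead (`isSumOfPowers_degenerate`).

Lower bounds: r powers bound the rank of the middle catalecticant by r. That matrix is an invertible
antidiagonal one plus a rank-one term from (ax + by)^(2k), so its rank is at least k
(`le_of_isSumOfPowers`), and it is singular only for critical c (ab)^k
(`mul_pow_eq_criticalCoeff_of_isSumOfPowers`). -/

theorem isHomogeneous_one_eq {l : MvPolynomial (Fin 2) ℂ} (hl : l.IsHomogeneous 1) :
    ∃ p q : ℂ, l = C p * X 0 + C q * X 1 := by
  have h := hl.sum_X_mul_pderiv
  have hc (i : Fin 2) : ∃ p : ℂ, pderiv i l = C p := by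
    have := hl.pderiv (i := i)
    exact ⟨_, totalDegree_eq_zero_iff_eq_C.mp (Nat.le_zero.mp this.totalDegree_le)⟩
  obtain ⟨p, hp⟩ := hc 0
  obtain ⟨q, hq⟩ := hc 1
  refine ⟨p, q, ?_⟩
  rw [Fin.sum_univ_two, hp, hq, one_smul] at h
  rw [← h]
  ring

theorem isHomogeneous_one_C_mul {σ : Type*} {l : MvPolynomial σ ℂ} (hl : l.IsHomogeneous 1)
    (p : ℂ) : (C p * l).IsHomogeneous 1 := by
  simpa using (isHomogeneous_C σ p).mul hl

namespace IsSumOfPowers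

variable {σ : Type*} {d : ℕ} {f g : MvPolynomial σ ℂ} {r s : ℕ}

theorem add (hf : IsSumOfPowers d f r) (hg : IsSumOfPowers d g s) :
    IsSumOfPowers d (f + g) (r + s) := by
  obtain ⟨l, hl, rfl⟩ := hf
  obtain ⟨m, hm, rfl⟩ := hg
  refine ⟨Fin.append l m, fun i => ?_, ?_⟩
  · induction i using Fin.addCases with
    | left i => simpa using hl i
    | right i => simpa using hm i
  · simp [Fin.sum_univ_add]

theorem C_mul (hd : d ≠ 0) (c : ℂ) (hf : IsSumOfPowers d f r) :
    IsSumOfPowers d (C c * f) r := by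
  obtain ⟨l, hl, rfl⟩ := hf
  obtain ⟨z, rfl⟩ := IsAlgClosed.exists_pow_nat_eq c (Nat.pos_of_ne_zero hd)
  exact ⟨fun i => C z * l i, fun i => isHomogeneous_one_C_mul (hl i) z, by
    simp [mul_pow, Finset.mul_sum]⟩

theorem sum_range (hd : d ≠ 0) (n : ℕ) (w : ℕ → ℂ) (l : ℕ → MvPolynomial σ ℂ)
    (hl : ∀ i, (l i).IsHomogeneous 1) :
    IsSumOfPowers d (∑ i ∈ Finset.range n, C (w i) * l i ^ d) n := by
  induction n with
  | zero => exact ⟨Fin.elim0, fun i => i.elim0, by simp⟩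
  | succ n ih =>
    rw [Finset.sum_range_succ]
    exact ih.add (C_mul hd _ ⟨fun _ => l n, fun _ => hl n, by simp⟩)

end IsSumOfPowers

/-! ### Averages over roots of unity -/

theorem IsPrimitiveRoot.sum_pow_mul {R : Type*} [CommRing R] [IsDomain R] {z : R} {n : ℕ}
    (hz : IsPrimitiveRoot z n) (m : ℕ) :
    ∑ j ∈ Finset.range n, z ^ (j * m) = if n ∣ m then (n : R) else 0 := by
  split_ifs with h
  · obtain ⟨t, rfl⟩ := h
    have (j : ℕ) : z ^ (j * (n * t)) = 1 := by
      rw [show j * (n * t) = n * (j * t) by ring, pow_mul, hz.pow_eq_one, one_pow]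
    simp [this]
  · have h1 : z ^ m - 1 ≠ 0 := by
      rwa [Ne, sub_eq_zero, hz.pow_eq_one_iff_dvd]
    have h2 := mul_geom_sum (z ^ m) n
    rw [← pow_mul, mul_comm m n, pow_mul, hz.pow_eq_one, one_pow, sub_self] at h2
    have h3 := (mul_eq_zero.mp h2).resolve_left h1
    simpa [← pow_mul, mul_comm] using h3

theorem IsPrimitiveRoot.sum_pow_mul_add_pow {R : Type*} [CommRing R] [IsDomain R] {z : R} {n : ℕ}
    (hz : IsPrimitiveRoot z n) (e d : ℕ) (A B : R) :
    ∑ j ∈ Finset.range n, z ^ (j * e) * (A + z ^ j * B) ^ d =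
      n * ∑ i ∈ Finset.range (d + 1),
        if n ∣ i + e then A ^ (d - i) * B ^ i * (d.choose i : R) else 0 := by
  have (j : ℕ) : z ^ (j * e) * (A + z ^ j * B) ^ d =
      ∑ i ∈ Finset.range (d + 1),
        z ^ (j * (i + e)) * (A ^ (d - i) * B ^ i * (d.choose i : R)) := by
    rw [add_comm A, add_pow, Finset.mul_sum]
    refine Finset.sum_congr rfl fun i _ => ?_
    rw [mul_pow, ← pow_mul, mul_add, pow_add]
    ring
  simp_rw [this]
  rw [Finset.sum_comm, Finset.mul_sum]
  refine Finset.sum_congr rfl fun i _ => ?_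
  rw [← Finset.sum_mul, hz.sum_pow_mul]
  split_ifs <;> simp

/-- Among 0 ≤ i ≤ 2k, only i = k makes i + 1 divisible by k + 1. -/
theorem sum_primitiveRoot_succ {R : Type*} [CommRing R] [IsDomain R] {z : R} {k : ℕ}
    (hz : IsPrimitiveRoot z (k + 1)) (A B : R) :
    ∑ j ∈ Finset.range (k + 1), z ^ j * (A + z ^ j * B) ^ (2 * k) =
      (k + 1) * (2 * k).choose k * (A ^ k * B ^ k) := by
  have h := hz.sum_pow_mul_add_pow 1 (2 * k) A B
  simp only [mul_one] at h
  rw [h, Finset.sum_eq_single k]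
  · rw [if_pos dvd_rfl, show 2 * k - k = k by omega]
    push_cast
    ring
  · intro i hi hik
    rw [if_neg]
    rintro ⟨t, ht⟩
    rw [Finset.mem_range] at hi
    have : t < 2 := by nlinarith
    interval_cases t <;> omega
  · intro h
    simp at h
    omega

/-- The surviving exponents are the multiples 0, k, 2k of k. -/
theorem sum_primitiveRoot {R : Type*} [CommRing R] [IsDomain R] {z : R} {k : ℕ} (hk : 0 < k)
    (hz : IsPrimitiveRoot z k) (A B : R) :
    ∑ j ∈ Finset.range k, (A + z ^ j * B) ^ (2 * k) =
      k * (A ^ (2 * k) + (2 * k).choose k * (A ^ k * B ^ k) + B ^ (2 * k)) := by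
  have h := hz.sum_pow_mul_add_pow 0 (2 * k) A B
  simp only [mul_zero, pow_zero, one_mul, add_zero] at h
  rw [h, ← Finset.sum_subset (s₁ := {0, k, 2 * k})]
  · rw [Finset.sum_insert (by simp; omega), Finset.sum_pair (by omega)]
    rw [if_pos (dvd_zero k), if_pos dvd_rfl, if_pos (Dvd.intro_left 2 rfl),
      show 2 * k - k = k by omega]
    simp only [tsub_zero, tsub_self, pow_zero, mul_one, one_mul, Nat.choose_zero_right,
      Nat.choose_self, Nat.cast_one]
    ring
  · intro i
    simp
    omega
  · intro i hi hik
    rw [if_neg]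
    rintro ⟨t, rfl⟩
    rw [Finset.mem_range] at hi
    have : t < 3 := by
      by_contra! ht
      nlinarith
    interval_cases t <;> simp [mul_comm] at hik

/-! ### Explicit decompositions -/

section UpperBounds

variable {σ : Type*} {k : ℕ} {A B : MvPolynomial σ ℂ}

/-- The coefficient at which the middle catalecticant of `x ^ k * y ^ k + c * (x + y) ^ (2 * k)`
degenerates. -/
noncomputable def criticalCoeff (k : ℕ) : ℂ := -(((k + 1) * (2 * k).choose k : ℂ))⁻¹

theorem choose_ne_zero_complex (k : ℕ) : ((2 * k).choose k : ℂ) ≠ 0 :=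
  Nat.cast_ne_zero.mpr (Nat.choose_pos (by omega)).ne'

theorem criticalCoeff_ne_zero (k : ℕ) : criticalCoeff k ≠ 0 :=
  neg_ne_zero.mpr (inv_ne_zero (mul_ne_zero (Nat.cast_add_one_ne_zero k)
    (choose_ne_zero_complex k)))

theorem isSumOfPowers_critical (hk : 0 < k) (hA : A.IsHomogeneous 1) (hB : B.IsHomogeneous 1) :
    IsSumOfPowers (2 * k) (A ^ k * B ^ k + C (criticalCoeff k) * (A + B) ^ (2 * k)) k := by
  have hz := (Complex.isPrimitiveRoot_exp (k + 1) k.succ_ne_zero)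
  set z := Complex.exp (2 * Real.pi * Complex.I / (k + 1 : ℕ))
  have h := sum_primitiveRoot_succ (hz.map_of_injective (C_injective σ ℂ)) A B
  have hN : ((k + 1) * (2 * k).choose k : ℂ) * -criticalCoeff k = 1 := by
    rw [criticalCoeff, neg_neg]
    exact mul_inv_cancel₀ (mul_ne_zero (Nat.cast_add_one_ne_zero k) (choose_ne_zero_complex k))
  have hN' : ((k + 1) * (2 * k).choose k : MvPolynomial σ ℂ) * -C (criticalCoeff k) = 1 := by
    have := congrArg (C (σ := σ)) hN
    simpa using this
  have key := IsSumOfPowers.sum_range (d := 2 * k) (by omega) k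
    (fun j => -criticalCoeff k * z ^ (j + 1)) (fun j => A + C (z ^ (j + 1)) * B)
    (fun j => hA.add (isHomogeneous_one_C_mul hB _))
  convert key using 1
  rw [Finset.sum_range_succ'] at h
  simp only [C_mul, C_neg, C_pow, mul_assoc, ← Finset.mul_sum]
  simp only [pow_zero, one_mul] at h
  linear_combination (C (criticalCoeff k)) * h - A ^ k * B ^ k * hN'

theorem isSumOfPowers_generic (hk : 0 < k) (hA : A.IsHomogeneous 1) (hB : B.IsHomogeneous 1)
    (c : ℂ) : IsSumOfPowers (2 * k) (A ^ k * B ^ k + C c * (A + B) ^ (2 * k)) (k + 1) := by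
  have h1 : IsSumOfPowers (2 * k) ((A + B) ^ (2 * k)) 1 :=
    ⟨fun _ => A + B, fun _ => hA.add hB, by simp⟩
  convert (isSumOfPowers_critical hk hA hB).add
    (h1.C_mul (by omega) (c - criticalCoeff k)) using 1
  rw [C_sub]
  ring

theorem isSumOfPowers_degenerate (hk : 0 < k) (hA : A.IsHomogeneous 1) (hB : B.IsHomogeneous 1)
    {c : ℂ} (hc : c ≠ 0) :
    IsSumOfPowers (2 * k) (A ^ k * B ^ k + C c * A ^ (2 * k)) (k + 1) := by
  have hz := Complex.isPrimitiveRoot_exp k hk.ne'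
  set z := Complex.exp (2 * Real.pi * Complex.I / k)
  -- Rescaling B by ρ gives A^k B^k coefficient 1; one further power then cancels the B^(2k) term.
  obtain ⟨ρ, hρ⟩ := IsAlgClosed.exists_pow_nat_eq (((2 * k).choose k : ℂ) * c)⁻¹ hk
  have h := sum_primitiveRoot hk (hz.map_of_injective (C_injective σ ℂ)) A (C ρ * B)
  have h0 : IsSumOfPowers (2 * k) (B ^ (2 * k)) 1 := ⟨fun _ => B, fun _ => hB, by simp⟩
  have key := (IsSumOfPowers.sum_range (d := 2 * k) (by omega) k
    (fun _ => c / k) (fun j => A + C (z ^ j) * (C ρ * B))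
    (fun j => hA.add (isHomogeneous_one_C_mul (isHomogeneous_one_C_mul hB _) _))).add
    (h0.C_mul (by omega) (-(c * ρ ^ (2 * k))))
  convert key using 1
  have e1 : (C (c / k) * (k : MvPolynomial σ ℂ)) = C c := by
    have : (c / k) * (k : ℂ) = c := div_mul_cancel₀ _ (Nat.cast_ne_zero.mpr hk.ne')
    simpa only [C_mul, map_natCast] using congrArg (C (σ := σ)) this
  have e2 : C c * ((2 * k).choose k : MvPolynomial σ ℂ) * C ρ ^ k = 1 := by
    have : c * ((2 * k).choose k : ℂ) * ρ ^ k = 1 := by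
      rw [hρ]
      have := choose_ne_zero_complex k
      field_simp
    simpa only [C_mul, map_natCast, C_pow, C_1] using congrArg (C (σ := σ)) this
  simp only [C_mul, C_neg, C_pow, ← Finset.mul_sum]
  rw [h, mul_pow, mul_pow]
  linear_combination -(A ^ (2 * k) + (2 * k).choose k * (A ^ k * (C ρ ^ k * B ^ k)) +
    C ρ ^ (2 * k) * B ^ (2 * k)) * e1 - A ^ k * B ^ k * e2

end UpperBounds

/-! ### Lower bounds from the catalecticant -/

theorem coeff_C_add_C_mul_X_pow (p q : ℂ) (n i : ℕ) :
    ((Polynomial.C p + Polynomial.C q * Polynomial.X) ^ n).coeff i =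
      n.choose i * (p ^ (n - i) * q ^ i) := by
  have : (Polynomial.C p + Polynomial.C q * Polynomial.X) ^ n =
      ∑ m ∈ Finset.range (n + 1),
        Polynomial.C (n.choose m * (p ^ (n - m) * q ^ m)) * Polynomial.X ^ m := by
    rw [add_comm, add_pow]
    refine Finset.sum_congr rfl fun m _ => ?_
    simp only [mul_pow, map_mul, map_pow, map_natCast]
    ring
  rw [this, Polynomial.finsetSum_coeff]
  simp only [Polynomial.coeff_C_mul_X_pow]
  rw [Finset.sum_ite_eq]
  split_ifs with h
  · rfl
  · rw [Nat.choose_eq_zero_of_lt (by simpa using h)]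
    simp

theorem moments_of_isSumOfPowers {k r : ℕ} {a b c : ℂ}
    (h : IsSumOfPowers (2 * k) (binaryForm k a b c) r) :
    ∃ p q : Fin r → ℂ, ∀ i ≤ 2 * k, ∑ j, p j ^ (2 * k - i) * q j ^ i =
      c * (a ^ (2 * k - i) * b ^ i) + if i = k then ((2 * k).choose k : ℂ)⁻¹ else 0 := by
  obtain ⟨l, hl, hf⟩ := h
  choose p q hpq using fun j => isHomogeneous_one_eq (hl j)
  refine ⟨p, q, fun i hi => ?_⟩
  -- Dehomogenise by x = 1 and compare coefficients of y^i.
  have h1 := congrArg (fun f => (aeval ![1, Polynomial.X] f : Polynomial ℂ).coeff i) hf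
  simp only [binaryForm, hpq, map_add, map_mul, map_pow, map_sum, aeval_X, aeval_C,
    Polynomial.algebraMap_eq, Matrix.cons_val_zero, Matrix.cons_val_one, mul_one, one_pow, one_mul,
    Polynomial.coeff_add, Polynomial.coeff_C_mul, Polynomial.finsetSum_coeff,
    coeff_C_add_C_mul_X_pow, Polynomial.coeff_X_pow, ← Finset.mul_sum] at h1
  have h2 : ((2 * k).choose i : ℂ) ≠ 0 := Nat.cast_ne_zero.mpr (Nat.choose_pos hi).ne'
  apply mul_left_cancel₀ h2
  rw [← h1]
  split_ifs with hik
  · subst hik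
    field_simp
    ring
  · ring

/-- A vector in the kernel of the middle catalecticant spans the direction dual to `a x + b y`. -/
theorem catalecticant_kernel {k r : ℕ} {a b c : ℂ} {p q : Fin r → ℂ}
    (h : ∀ i ≤ 2 * k, ∑ j, p j ^ (2 * k - i) * q j ^ i =
      c * (a ^ (2 * k - i) * b ^ i) + if i = k then ((2 * k).choose k : ℂ)⁻¹ else 0)
    (u : ℕ → ℂ)
    (hu : ∀ j, ∑ i ∈ Finset.range (k + 1), p j ^ (k - i) * q j ^ i * u i = 0)
    {m : ℕ} (hm : m ≤ k) :
    c * (∑ i ∈ Finset.range (k + 1), a ^ (k - i) * b ^ i * u i) * (a ^ m * b ^ (k - m)) +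
      ((2 * k).choose k : ℂ)⁻¹ * u m = 0 := by
  have split (x y : ℂ) {i : ℕ} (hi : i ∈ Finset.range (k + 1)) :
      x ^ (2 * k - (i + (k - m))) * y ^ (i + (k - m)) =
        x ^ (k - i) * y ^ i * (x ^ m * y ^ (k - m)) := by
    rw [Finset.mem_range] at hi
    rw [show 2 * k - (i + (k - m)) = (k - i) + m by omega, pow_add, pow_add]
    ring
  -- Row k - m of the catalecticant: its antidiagonal entry lies in column m.
  have h1 : ∑ i ∈ Finset.range (k + 1), u i *
      ∑ j, p j ^ (2 * k - (i + (k - m))) * q j ^ (i + (k - m)) = 0 := by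
    simp_rw [Finset.mul_sum]
    rw [Finset.sum_comm]
    refine Finset.sum_eq_zero fun j _ => ?_
    rw [← zero_mul (p j ^ m * q j ^ (k - m)), ← hu j, Finset.sum_mul]
    refine Finset.sum_congr rfl fun i hi => ?_
    rw [split _ _ hi]
    ring
  rw [← h1, Finset.mul_sum, Finset.sum_mul]
  have h2 : ((2 * k).choose k : ℂ)⁻¹ * u m = ∑ i ∈ Finset.range (k + 1),
      if i = m then ((2 * k).choose k : ℂ)⁻¹ * u i else 0 := by
    rw [Finset.sum_ite_eq', if_pos (Finset.mem_range.mpr (by omega))]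
  rw [h2, ← Finset.sum_add_distrib]
  refine Finset.sum_congr rfl fun i hi => ?_
  have hi' := Finset.mem_range.mp hi
  rw [h _ (by omega), split _ _ hi]
  by_cases him : i = m
  · rw [if_pos him, if_pos (by omega)]
    ring
  · rw [if_neg him, if_neg (by omega)]
    ring

theorem exists_ne_zero_sum_eq_zero {k : ℕ} {ι : Type*} [Fintype ι] (hι : Fintype.card ι ≤ k)
    (w : ι → ℕ → ℂ) :
    ∃ u : ℕ → ℂ, (∃ i ≤ k, u i ≠ 0) ∧ ∀ j, ∑ i ∈ Finset.range (k + 1), w j i * u i = 0 := by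
  have hker := LinearMap.ker_ne_bot_of_finrank_lt
    (f := Matrix.mulVecLin (Matrix.of fun (j : ι) (i : Fin (k + 1)) => w j i)) (by simp; omega)
  obtain ⟨u, hu, hu0⟩ := (Submodule.ne_bot_iff _).mp hker
  obtain ⟨i, hi⟩ := Function.ne_iff.mp hu0
  refine ⟨fun i => if h : i < k + 1 then u ⟨i, h⟩ else 0,
    ⟨i, by omega, by
      simpa only [i.isLt, dif_pos, Fin.eta, Pi.zero_apply] using hi⟩,
    fun j => ?_⟩
  have := congrFun (LinearMap.mem_ker.mp hu) j
  simp only [Matrix.mulVecLin_apply, Matrix.mulVec, dotProduct, Matrix.of_apply,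
    Pi.zero_apply] at this
  rw [Finset.sum_range]
  simpa only [Fin.is_lt, dif_pos, Fin.eta] using this

theorem le_of_isSumOfPowers {k r : ℕ} {a b c : ℂ}
    (h : IsSumOfPowers (2 * k) (binaryForm k a b c) r) : k ≤ r := by
  by_contra! hr
  obtain ⟨p, q, hpq⟩ := moments_of_isSumOfPowers h
  -- The extra index `none` also makes u orthogonal to the rank-one term; r + 1 ≤ k equations still
  -- leave a nonzero u.
  obtain ⟨u, ⟨m, hm, hum⟩, hu⟩ := exists_ne_zero_sum_eq_zero (k := k) (ι := Option (Fin r))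
    (by simpa using hr)
    (fun j i => j.elim (a ^ (k - i) * b ^ i) fun j => p j ^ (k - i) * q j ^ i)
  have key := catalecticant_kernel hpq u (fun j => hu (some j)) hm
  have hv := hu none
  simp only [Option.elim_none] at hv
  rw [hv, mul_zero, zero_mul, zero_add] at key
  exact mul_ne_zero (inv_ne_zero (choose_ne_zero_complex k)) hum key

theorem mul_pow_eq_criticalCoeff_of_isSumOfPowers {k r : ℕ} {a b c : ℂ}
    (h : IsSumOfPowers (2 * k) (binaryForm k a b c) r) (hr : r ≤ k) :
    c * (a * b) ^ k = criticalCoeff k := by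
  obtain ⟨p, q, hpq⟩ := moments_of_isSumOfPowers h
  obtain ⟨u, ⟨m, hm, hum⟩, hu⟩ := exists_ne_zero_sum_eq_zero (k := k) (ι := Fin r)
    (by simpa using hr) (fun j i => p j ^ (k - i) * q j ^ i)
  have key {m : ℕ} (hm : m ≤ k) := catalecticant_kernel hpq u hu hm
  set S := ∑ i ∈ Finset.range (k + 1), a ^ (k - i) * b ^ i * u i with hS
  have hα := choose_ne_zero_complex k
  have hS0 : S ≠ 0 := by
    intro h0
    have := key hm
    rw [h0, mul_zero, zero_mul, zero_add] at this
    exact mul_ne_zero (inv_ne_zero hα) hum this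
  -- Pair the kernel relations with a^(k-i) b^i: each of the k + 1 rows contributes the same c S
  -- (ab)^k.
  have h1 : (k + 1) * (c * S * (a * b) ^ k) + ((2 * k).choose k : ℂ)⁻¹ * S = 0 := by
    have : ∑ i ∈ Finset.range (k + 1), (c * S * (a * b) ^ k +
        ((2 * k).choose k : ℂ)⁻¹ * (a ^ (k - i) * b ^ i * u i)) = 0 := by
      refine Finset.sum_eq_zero fun i hi => ?_
      have hik : i ≤ k := by simpa [Nat.lt_succ_iff] using hi
      have e (x : ℂ) : x ^ k = x ^ (k - i) * x ^ i := by rw [← pow_add, Nat.sub_add_cancel hik]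
      rw [mul_pow, e a, e b]
      linear_combination a ^ (k - i) * b ^ i * key hik
    rw [Finset.sum_add_distrib, ← Finset.mul_sum (f := fun i => a ^ (k - i) * b ^ i * u i),
      ← hS] at this
    simpa using this
  have hk1 : (k + 1 : ℂ) ≠ 0 := Nat.cast_add_one_ne_zero k
  rw [criticalCoeff]
  field_simp at h1 ⊢
  rw [mul_zero] at h1
  linear_combination (mul_eq_zero.mp h1).resolve_left hS0

/-! ### The rank of the binary form -/

theorem waringRank_binaryForm_of_ne {k : ℕ} {a b c : ℂ}
    (hupper : IsSumOfPowers (2 * k) (binaryForm k a b c) (k + 1))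
    (hne : c * (a * b) ^ k ≠ criticalCoeff k) :
    waringRank (2 * k) (binaryForm k a b c) = ((k + 1 : ℕ) : ℕ∞) := by
  refine (waringRank_eq_iff _ _ _).mpr ⟨hupper, fun r hr => ?_⟩
  by_contra! hlt
  exact hne (mul_pow_eq_criticalCoeff_of_isSumOfPowers hr (by omega))

/-- Taking A = ax and B = by reduces to a = b = 1. -/
theorem binaryForm_eq_C_mul {k : ℕ} {a b : ℂ} (hab : a * b ≠ 0) (c : ℂ) :
    binaryForm k a b c = C ((a * b) ^ k)⁻¹ * ((C a * X 0) ^ k * (C b * X 1) ^ k +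
      C (c * (a * b) ^ k) * (C a * X 0 + C b * X 1) ^ (2 * k)) := by
  have e : (C ((a * b) ^ k)⁻¹ * C ((a * b) ^ k) : MvPolynomial (Fin 2) ℂ) = 1 := by
    rw [← C_mul, inv_mul_cancel₀ (pow_ne_zero k hab), C_1]
  have e' : (C ((a * b) ^ k) : MvPolynomial (Fin 2) ℂ) = C a ^ k * C b ^ k := by
    rw [C_pow, C_mul, mul_pow]
  rw [binaryForm, MvPolynomial.C_mul (a := c), mul_pow (C a), mul_pow (C b)]
  generalize (C ((a * b) ^ k) : MvPolynomial (Fin 2) ℂ) = D at *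
  generalize (C ((a * b) ^ k)⁻¹ : MvPolynomial (Fin 2) ℂ) = E at *
  linear_combination -(X 0 ^ k * X 1 ^ k + C c * (C a * X 0 + C b * X 1) ^ (2 * k)) * e +
    E * X 0 ^ k * X 1 ^ k * e'

theorem isSumOfPowers_binaryForm {k : ℕ} (hk : 0 < k) (a b : ℂ) {c : ℂ} (hc : c ≠ 0) :
    IsSumOfPowers (2 * k) (binaryForm k a b c) (k + 1) := by
  have h0 := isHomogeneous_X ℂ (0 : Fin 2)
  have h1 := isHomogeneous_X ℂ (1 : Fin 2)
  by_cases ha : a = 0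
  · subst ha
    by_cases hb : b = 0
    · subst hb
      convert isSumOfPowers_generic hk h0 h1 0 using 1
      simp [binaryForm, hk.ne']
    · convert isSumOfPowers_degenerate hk h1 h0 (mul_ne_zero hc (pow_ne_zero (2 * k) hb)) using 1
      simp only [binaryForm, C_0, C_mul, C_pow]
      ring
  · by_cases hb : b = 0
    · subst hb
      convert isSumOfPowers_degenerate hk h0 h1 (mul_ne_zero hc (pow_ne_zero (2 * k) ha)) using 1
      simp only [binaryForm, C_0, C_mul, C_pow]
      ring
    · rw [binaryForm_eq_C_mul (mul_ne_zero ha hb)]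
      exact (isSumOfPowers_generic hk (isHomogeneous_one_C_mul h0 a)
        (isHomogeneous_one_C_mul h1 b) _).C_mul (by omega) _

theorem theorem3p4 (k : ℕ) (hk : 2 ≤ k) (a b : ℂ) :
    (a * b ≠ 0 →
      ∃! c₀ : ℂ, c₀ ≠ 0 ∧ ∀ c : ℂ, c ≠ 0 →
        (c = c₀ → waringRank (2 * k) (binaryForm k a b c) = (k : ℕ∞)) ∧
        (c ≠ c₀ → waringRank (2 * k) (binaryForm k a b c) = ((k + 1 : ℕ) : ℕ∞))) ∧
    (a * b = 0 →
      ∀ c : ℂ, c ≠ 0 →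
        waringRank (2 * k) (binaryForm k a b c) = ((k + 1 : ℕ) : ℕ∞)) := by
  have hk0 : 0 < k := by omega
  refine ⟨fun hab => ?_, fun hab c hc => ?_⟩
  · have hpow : (a * b) ^ k ≠ 0 := pow_ne_zero k hab
    have main : ∀ c : ℂ, c ≠ 0 →
        (c = criticalCoeff k / (a * b) ^ k →
          waringRank (2 * k) (binaryForm k a b c) = (k : ℕ∞)) ∧
        (c ≠ criticalCoeff k / (a * b) ^ k →
          waringRank (2 * k) (binaryForm k a b c) = ((k + 1 : ℕ) : ℕ∞)) := by
      refine fun c hc => ⟨fun h => ?_, fun h => ?_⟩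
      · refine (waringRank_eq_iff _ _ _).mpr ⟨?_, fun r hr => le_of_isSumOfPowers hr⟩
        rw [Set.mem_ofPred_eq, binaryForm_eq_C_mul hab, (eq_div_iff hpow).mp h]
        exact (isSumOfPowers_critical hk0 (isHomogeneous_one_C_mul (isHomogeneous_X ℂ 0) a)
          (isHomogeneous_one_C_mul (isHomogeneous_X ℂ 1) b)).C_mul (by omega) _
      · exact waringRank_binaryForm_of_ne (isSumOfPowers_binaryForm hk0 a b hc)
          fun h' => h ((eq_div_iff hpow).mpr h')
    have hne : criticalCoeff k / (a * b) ^ k ≠ 0 := div_ne_zero (criticalCoeff_ne_zero k) hpow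
    refine ⟨_, ⟨hne, main⟩, fun c₁ ⟨hc₁, h₁⟩ => ?_⟩
    -- A second exceptional value would have rank both k and k + 1.
    by_contra hcon
    have e := ((main c₁ hc₁).2 hcon).symm.trans ((h₁ c₁ hc₁).1 rfl)
    exact k.succ_ne_self (by exact_mod_cast e)
  · refine waringRank_binaryForm_of_ne (isSumOfPowers_binaryForm hk0 a b hc) ?_
    rw [hab, zero_pow hk0.ne', mul_zero]
    exact (criticalCoeff_ne_zero k).symm
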